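/- Let $M$ be a compact smooth manifold (for instance a compact Riemannian manifold). For $n\ge 1$ let $(P^{(n)}_t)_{t\ge0}$ be a Feller semigroup on $C(M^n)$, that is, a strongly continuous semigroup of positive linear operators with $P^{(n)}_0=\mathrm{Id}$ and $P^{(n)}_t1=1$. Suppose that the family $(P^{(n)}_t)_{n\ge1}$ is CDP, that is: * (compatible) whenever $1\le k<n$, $i_1,\dots,i_k\in\{1,\dots,n\}$ are distinct, and $f\in C(M^n)$, $\bar f\in C(M^k)$ satisfy $f(x_1,\dots,x_n)=\bar f(x_{i_1},\dots,x_{i_k})$, one has $P^{(n)}_tf(x_1,\dots,x_n)=P^{(k)}_t\bar f(x_{i_1},\dots,x_{i_k})$ for all $t\ge 0$ and all $x_1,\dots,x_n\in M$; * (diagonal preserving) $P^{(2)}_tf^{\otimes2}(x,x)=P^{(1)}_tf^2(x)$ for all $f\in C(M)$, $x\in M$ and $t\ge 0$. A submanifold of $M$ is the image $N=\iota(W)$ of a connected (Hausdorff, second countable) smooth manifold $W$ under an injective smooth immersion $\iota:W\to M$; it carries the intrinsic topology, transported from $W$. A Feller semigroup $P_t$ on $C(X)$ is degenerate along such an injected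 subspace $N\subset X$ if there is a Markovian semigroup $P^N_t$ on $N$ (a semigroup of Markov transition kernels on $N$ with the Borel $\sigma$-algebra of its intrinsic topology, with $P^N_0=\mathrm{Id}$) such that $P_tf(x)=P^N_t(f|_N)(x)$ for all $t\ge0$, $f\in C(X)$ and $x\in N$. The product $N^n\subset M^n$ carries the product of the intrinsic topologies. A foliation $\mathcal F$ of $M$ is given by a smooth atlas whose charts $\psi:U\to\mathbb R^d\times\mathbb R^q$, $d+q=\dim M$, have images $U_1\times U_2$ with $U_1,U_2$ open and $U_1$ connected, and whose changes of charts have the form $(x,y)\mapsto(h_1(x,y),h_2(y))$. Its leaves are the classes of points joined by finite chains of plaques $\psi^{-1}(U_1\times\{c\})$, with the intrinsic topology generated by the relatively open subsets of plaques. The leaves of the product foliation $\mathcal F^n$ of $M^n$ are the products $\mathcal L_1\times\dots\times\mathcal L_n$ of leaves of $\mathcal F$, with the product of the intrinsic topologies, and a Feller semigroup on $C(M^n)$ is $\mathcal F^n$-foliated if it is degenerate along every leaf of $\mathcal F^n$. 1. Let $N$ be a submanifold of $M$. If $P^{(k)}_t$ is $N^k$-degenerate for some $k\ge1$, then $P^{(n)}_t$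 is $N^n$-degenerate for every $n\ge1$. 2. Let $\mathcal F$ be a foliation of $M$. If $P^{(k)}_t$ is $\mathcal F^k$-foliated for some $k\ge1$, then $P^{(n)}_t$ is $\mathcal F^n$-foliated for every $n\ge1$. -/

import Mathlib

open Set Filter Topology MeasureTheory ProbabilityTheory
open scoped NNReal Manifold ContDiff

/-- A (conservative) Feller semigroup on `C(X)`, for a compact space `X`: a strongly continuous
semigroup of positive linear operators preserving the constant function `1`. -/
structure FellerSemigroup (X : Type*) [TopologicalSpace X] [CompactSpace X] where
  op : ℝ≥0 → C(X, ℝ) →L[ℝ] C(X, ℝ)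
  op_zero : op 0 = ContinuousLinearMap.id ℝ C(X, ℝ)
  op_add : ∀ s t, op (s + t) = (op s).comp (op t)
  op_nonneg : ∀ t f, 0 ≤ f → 0 ≤ op t f
  op_one : ∀ t, op t 1 = 1
  tendsto_op : ∀ f, Tendsto (fun t => op t f) (𝓝 0) (𝓝 f)

/-- A Markovian semigroup on a measurable space: a semigroup of Markov transition kernels, acting
on bounded measurable functions by `g ↦ (x ↦ ∫ g(y) κ_t(x, dy))`. -/
structure MarkovSemigroup (S : Type*) [MeasurableSpace S] where
  kernel : ℝ≥0 → Kernel S S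
  isMarkovKernel : ∀ t, IsMarkovKernel (kernel t)
  kernel_zero : kernel 0 = Kernel.id
  kernel_add : ∀ s t, kernel (s + t) = kernel s ∘ₖ kernel t

/-- A family of Feller semigroups, the `n`-th one on `C(M^n)`, is compatible and diagonal
preserving. The index `n = 0`, where `M^0` is a point, carries no information and is not used. -/
structure IsCDP {M : Type*} [TopologicalSpace M] [CompactSpace M]
    (P : ∀ n : ℕ, FellerSemigroup (Fin n → M)) : Prop where
  compatible : ∀ k n : ℕ, 1 ≤ k → k < n → ∀ i : Fin k → Fin n, Function.Injective i →
    ∀ (t : ℝ≥0) (f : C(Fin n → M, ℝ)) (g : C(Fin k → M, ℝ)),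
      (∀ x : Fin n → M, f x = g (fun j => x (i j))) →
      ∀ x : Fin n → M, (P n).op t f x = (P k).op t g (fun j => x (i j))
  diagonal : ∀ (t : ℝ≥0) (f : C(M, ℝ)) (x : M),
    (P 2).op t ⟨fun z => f (z 0) * f (z 1), by fun_prop⟩ (fun _ => x) =
      (P 1).op t ⟨fun z => f (z 0) ^ 2, by fun_prop⟩ (fun _ => x)

/-- The Feller semigroup `P` on `C(X)` is degenerate along the image `N = ι(W)` of an injective
map `ι : W → X`, where `N` carries the intrinsic topology, that of `W`: there is a Markovian
semigroup `Q` on the Borel space `W` such that `P_t f (x) = Q_t (f|_N) (x)` for all `f ∈ C(X)`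
and all `x ∈ N`. -/
def FellerSemigroup.IsDegenerate {X : Type*} [TopologicalSpace X] [CompactSpace X]
    (P : FellerSemigroup X) {W : Type*} [TopologicalSpace W] (ι : W → X) : Prop :=
  letI : MeasurableSpace W := borel W
  ∃ Q : MarkovSemigroup W, ∀ (t : ℝ≥0) (f : C(X, ℝ)) (w : W),
    P.op t f (ι w) = ∫ v, f (ι v) ∂(Q.kernel t w)

/-- A smooth regular foliation of an `m`-dimensional manifold with leaves of dimension `d` and
codimension `q`, given by a foliated atlas: the charts take values in `ℝ^d × ℝ^q`, their images
are products `U₁ × U₂` (with `U₁` connected, so that the plaques `U₁ × {c}` are connected), and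
the second component of a change of charts depends only on the second coordinate. -/
structure Foliation (m d q : ℕ) (M : Type*) [TopologicalSpace M]
    [ChartedSpace (EuclideanSpace ℝ (Fin m)) M] where
  charts : Set (OpenPartialHomeomorph M (EuclideanSpace ℝ (Fin d) × EuclideanSpace ℝ (Fin q)))
  dim_eq : d + q = m
  exists_mem_source : ∀ x : M, ∃ ψ ∈ charts, x ∈ ψ.source
  contMDiffOn : ∀ ψ ∈ charts,
    ContMDiffOn (𝓡 m) 𝓘(ℝ, EuclideanSpace ℝ (Fin d) × EuclideanSpace ℝ (Fin q)) ∞ ψ ψ.source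
  contMDiffOn_symm : ∀ ψ ∈ charts,
    ContMDiffOn 𝓘(ℝ, EuclideanSpace ℝ (Fin d) × EuclideanSpace ℝ (Fin q)) (𝓡 m) ∞
      ψ.symm ψ.target
  target_eq_prod : ∀ ψ ∈ charts, ∃ (U₁ : Set (EuclideanSpace ℝ (Fin d)))
    (U₂ : Set (EuclideanSpace ℝ (Fin q))),
    IsOpen U₁ ∧ IsPreconnected U₁ ∧ IsOpen U₂ ∧ ψ.target = U₁ ×ˢ U₂
  transition : ∀ ψ ∈ charts, ∀ φ ∈ charts,
    ∃ h₂ : EuclideanSpace ℝ (Fin q) → EuclideanSpace ℝ (Fin q),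
      ∀ z ∈ ψ.source ∩ φ.source, (φ z).2 = h₂ (ψ z).2

namespace Foliation

variable {m d q : ℕ} {M : Type*} [TopologicalSpace M] [ChartedSpace (EuclideanSpace ℝ (Fin m)) M]

/-- The plaque `ψ⁻¹(U₁ × {c})` of a foliated chart `ψ`. -/
def plaque (ψ : OpenPartialHomeomorph M (EuclideanSpace ℝ (Fin d) × EuclideanSpace ℝ (Fin q)))
    (c : EuclideanSpace ℝ (Fin q)) : Set M :=
  {z | z ∈ ψ.source ∧ (ψ z).2 = c}

/-- Two points lie in the same leaf if they are joined by a finite chain of plaques. -/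
def SameLeaf (F : Foliation m d q M) : M → M → Prop :=
  Relation.EqvGen fun x y => ∃ ψ ∈ F.charts, ∃ c, x ∈ plaque ψ c ∧ y ∈ plaque ψ c

/-- The leaf topology on `M`, whose basic open sets are the relatively open subsets of plaques. -/
abbrev leafTopology (F : Foliation m d q M) : TopologicalSpace M :=
  TopologicalSpace.generateFrom
    {s | ∃ ψ ∈ F.charts, ∃ c, ∃ O : Set M, IsOpen O ∧ s = O ∩ plaque ψ c}

/-- The leaf `𝓛_x` through `x`, as a space of its own. -/
def Leaf (F : Foliation m d q M) (x : M) : Type _ := {y : M // F.SameLeaf x y}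

/-- The inclusion of a leaf in `M`. -/
def Leaf.incl (F : Foliation m d q M) (x : M) (y : F.Leaf x) : M := y.1

/-- The intrinsic topology of a leaf. -/
instance (F : Foliation m d q M) (x : M) : TopologicalSpace (F.Leaf x) :=
  TopologicalSpace.induced (Leaf.incl F x) F.leafTopology

/-- `P` is foliated for the product foliation `𝓕^n` of `M^n`: it is degenerate along every leaf
`𝓛_{x_1} × ⋯ × 𝓛_{x_n}`, with the product of the intrinsic topologies. -/
def IsFoliatedPow [CompactSpace M] (F : Foliation m d q M) (n : ℕ)
    (P : FellerSemigroup (Fin n → M)) : Prop :=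
  ∀ x : Fin n → M,
    P.IsDegenerate (fun (y : ∀ j, F.Leaf (x j)) (j : Fin n) => Leaf.incl F (x j) (y j))

end Foliation

/-!
Let `e : W → X` be continuous and injective with `W` σ-compact. It maps compact pieces of `W`
homeomorphically onto closed sets, hence is a measurable embedding, and a Feller semigroup on
`C(X)` is degenerate along `e` iff its transition probabilities from points of the image are carried
by the image: the restricted kernels then form the required semigroup. For a product of such maps
this is a condition on each coordinate separately, and by compatibility the law of one coordinate
is the same for every number of points.

Leaves are σ-compact because each is a union of countably many plaques. Fix countably many foliated
charts covering `M`. A plaque of any chart is connected, so it is crossed by a chain of plaques of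
these charts, and a chain is determined by its first plaque and its finite list of charts, since
the transverse coordinate in the next chart is a function of the present one.
-/

section Measure

variable {X : Type*} [TopologicalSpace X] [MeasurableSpace X] [BorelSpace X]

theorem measure_ext_of_forall_integral_continuousMap [CompactSpace X] [HasOuterApproxClosed X]
    {μ ν : Measure X} [IsFiniteMeasure μ] [IsFiniteMeasure ν]
    (h : ∀ f : C(X, ℝ), ∫ x, f x ∂μ = ∫ x, f x ∂ν) : μ = ν :=
  ext_of_forall_integral_eq_of_IsFiniteMeasure fun f => h f.toContinuousMap

theorem measurable_measure_of_forall_measurable_integral [HasOuterApproxClosed X]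
    {Y : Type*} [MeasurableSpace Y] {μ : Y → Measure X} [∀ y, IsProbabilityMeasure (μ y)]
    (h : ∀ f : C(X, ℝ), Measurable fun y => ∫ x, f x ∂(μ y)) : Measurable μ := by
  have hgen : ‹MeasurableSpace X› = MeasurableSpace.generateFrom {s : Set X | IsClosed s} :=
    (BorelSpace.measurable_eq (α := X)).trans borel_eq_generateFrom_isClosed
  refine .measure_of_isPiSystem_of_isProbabilityMeasure hgen isPiSystem_isClosed fun s hs => ?_
  have approx (n : ℕ) (y : Y) : ∫⁻ x, (hs.apprSeq n x : ENNReal) ∂(μ y) =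
      ENNReal.ofReal (∫ x, (hs.apprSeq n x : ℝ) ∂(μ y)) := by
    rw [← BoundedContinuousFunction.toReal_lintegral_coe_eq_integral, ENNReal.ofReal_toReal
      (BoundedContinuousFunction.lintegral_lt_top_of_nnreal (μ y) _).ne]
  refine measurable_of_tendsto_metrizable (fun n => ?_) (tendsto_pi_nhds.2 fun y =>
    HasOuterApproxClosed.tendsto_lintegral_apprSeq hs (μ y))
  simp only [approx]
  exact (h ⟨fun x => (hs.apprSeq n x : ℝ), by fun_prop⟩).ennreal_ofReal

theorem measurableEmbedding_of_continuous_injective [T2Space X] {W : Type*} [TopologicalSpace W]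
    [SigmaCompactSpace W] [MeasurableSpace W] [BorelSpace W] {e : W → X} (he : Continuous e)
    (hinj : Function.Injective e) : MeasurableEmbedding e where
  injective := hinj
  measurable := he.measurable
  measurableSet_image' s hs := by
    have hK (n : ℕ) : MeasurableEmbedding fun w : compactCovering W n => e w :=
      have := isCompact_iff_compactSpace.1 (isCompact_compactCovering W n)
      ((he.comp continuous_subtype_val).isClosedEmbedding
        (hinj.comp Subtype.val_injective)).measurableEmbedding
    have himage : e '' s = ⋃ n, (fun w : compactCovering W n => e w) '' (Subtype.val ⁻¹' s) := by
      simp only [← image_image e Subtype.val, Subtype.image_preimage_coe, ← image_iUnion,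
        ← iUnion_inter, iUnion_compactCovering, univ_inter]
    exact himage ▸ .iUnion fun n =>
      (hK n).measurableSet_image.2 (measurable_subtype_coe hs)

theorem map_comap_eq_self_of_ae_mem_range {α β : Type*} [MeasurableSpace α] [MeasurableSpace β]
    {e : α → β} (he : MeasurableEmbedding e) {μ : Measure β} (h : ∀ᵐ y ∂μ, y ∈ range e) :
    (μ.comap e).map e = μ := by
  rw [he.map_comap, Measure.restrict_eq_self_of_ae_mem h]

end Measure

/-- The restriction of a Markovian semigroup to a measurably embedded subspace which it almost
surely does not leave. -/
noncomputable def MarkovSemigroup.comap {X W : Type*} [MeasurableSpace X] [MeasurableSpace W]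
    (Q : MarkovSemigroup X) {e : W → X} (he : MeasurableEmbedding e)
    (h : ∀ t w, ∀ᵐ y ∂(Q.kernel t (e w)), y ∈ range e) : MarkovSemigroup W where
  kernel t := ((Q.kernel t).comap e he.measurable).comapRight he
  isMarkovKernel t := by
    have := Q.isMarkovKernel t
    exact Kernel.IsMarkovKernel.comapRight _ he fun w =>
      (mem_ae_iff_prob_eq_one he.measurableSet_range).1 (h t w)
  kernel_zero := by
    ext w : 1
    rw [Kernel.comapRight_apply, Kernel.comap_apply, Q.kernel_zero, Kernel.id_apply,
      Kernel.id_apply, ← Measure.map_dirac' he.measurable, he.comap_map]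
  kernel_add s t := by
    ext w A hA
    have heA := he.measurableSet_image.2 hA
    rw [Kernel.comapRight_apply' _ _ _ hA, Kernel.comap_apply, Q.kernel_add,
      Kernel.comp_apply' _ _ _ heA, Kernel.comp_apply' _ _ _ hA,
      ← map_comap_eq_self_of_ae_mem_range he (h t w),
      lintegral_map (Kernel.measurable_coe _ heA) he.measurable]
    simp only [Kernel.comapRight_apply, Kernel.comap_apply, he.comap_apply]

namespace FellerSemigroup

section Transition

variable {X : Type*} [TopologicalSpace X] [CompactSpace X] (P : FellerSemigroup X)

/-- The functional `f ↦ P_t f (x)`, on compactly supported functions as the Riesz representation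
theorem requires (on a compact space they are all the continuous functions). -/
noncomputable def evalFunctional (t : ℝ≥0) (x : X) :
    CompactlySupportedContinuousMap X ℝ →ₚ[ℝ] ℝ :=
  PositiveLinearMap.mk₀
    { toFun := fun f => P.op t f.toContinuousMap x
      map_add' := fun f g => congrArg (· x) ((P.op t).map_add f.toContinuousMap g.toContinuousMap)
      map_smul' := fun c f => congrArg (· x) ((P.op t).map_smul c f.toContinuousMap) }
    fun f hf => P.op_nonneg t f.toContinuousMap hf x

variable [T2Space X] [MeasurableSpace X] [BorelSpace X]

/-- The transition probability `P_t(x, ·)`, the measure representing `f ↦ P_t f (x)`. -/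
noncomputable def transitionMeasure (t : ℝ≥0) (x : X) : Measure X :=
  RealRMK.rieszMeasure (P.evalFunctional t x)

theorem integral_transitionMeasure (t : ℝ≥0) (x : X) (f : C(X, ℝ)) :
    ∫ y, f y ∂(P.transitionMeasure t x) = P.op t f x :=
  RealRMK.integral_rieszMeasure (P.evalFunctional t x)
    (CompactlySupportedContinuousMap.continuousMapEquiv f)

instance (t : ℝ≥0) (x : X) : IsProbabilityMeasure (P.transitionMeasure t x) where
  measure_univ := by
    have hone := P.integral_transitionMeasure t x 1
    rw [P.op_one] at hone
    simpa [Measure.real, ENNReal.toReal_eq_one_iff] using hone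

variable [HasOuterApproxClosed X]

/-- The kernel of transition probabilities `P_t(x, dy)` at time `t`. -/
noncomputable def transitionKernel (t : ℝ≥0) : Kernel X X where
  toFun := P.transitionMeasure t
  measurable' := measurable_measure_of_forall_measurable_integral fun f => by
    simp only [integral_transitionMeasure]
    exact (P.op t f).continuous.measurable

instance (t : ℝ≥0) : IsMarkovKernel (P.transitionKernel t) where
  isProbabilityMeasure x := inferInstanceAs (IsProbabilityMeasure (P.transitionMeasure t x))

theorem integral_transitionKernel (t : ℝ≥0) (x : X) (f : C(X, ℝ)) :
    ∫ y, f y ∂(P.transitionKernel t x) = P.op t f x :=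
  P.integral_transitionMeasure t x f

theorem eq_transitionKernel {t : ℝ≥0} {x : X} {μ : Measure X} [IsFiniteMeasure μ]
    (h : ∀ f : C(X, ℝ), ∫ y, f y ∂μ = P.op t f x) : μ = P.transitionKernel t x :=
  measure_ext_of_forall_integral_continuousMap fun f => by rw [h, integral_transitionKernel]

/-- The Markovian semigroup of the transition kernels of a Feller semigroup. -/
noncomputable def markovSemigroup : MarkovSemigroup X where
  kernel := P.transitionKernel
  isMarkovKernel _ := inferInstance
  kernel_zero := by
    ext x : 1
    exact (P.eq_transitionKernel fun f => by
      rw [Kernel.id_apply, integral_dirac, P.op_zero, ContinuousLinearMap.id_apply]).symm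
  kernel_add s t := by
    ext x : 1
    refine (P.eq_transitionKernel fun f => ?_).symm
    have hf := (BoundedContinuousFunction.mkOfCompact f).integrable
      ((P.transitionKernel s ∘ₖ P.transitionKernel t) x)
    calc ∫ y, f y ∂((P.transitionKernel s ∘ₖ P.transitionKernel t) x)
        = ∫ z, ∫ y, f y ∂(P.transitionKernel s z) ∂(P.transitionKernel t x) :=
          Kernel.integral_comp hf
      _ = P.op (s + t) f x := by
          simp only [integral_transitionKernel, add_comm s t, P.op_add,
            ContinuousLinearMap.comp_apply]

theorem isDegenerate_iff_forall_ae_mem_range {W : Type*} [TopologicalSpace W]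
    [SigmaCompactSpace W] {e : W → X} (he : Continuous e) (hinj : Function.Injective e) :
    P.IsDegenerate e ↔ ∀ t w, ∀ᵐ y ∂(P.transitionKernel t (e w)), y ∈ range e := by
  borelize W
  have hemb := measurableEmbedding_of_continuous_injective he hinj
  constructor
  · rintro ⟨Q, hQ⟩ t w
    have := Q.isMarkovKernel t
    have := Measure.isProbabilityMeasure_map (μ := Q.kernel t w) he.measurable.aemeasurable
    have hmap : (Q.kernel t w).map e = P.transitionKernel t (e w) :=
      P.eq_transitionKernel fun f => by rw [hemb.integral_map, hQ]
    exact hmap ▸ hemb.ae_map_iff.2 (.of_forall mem_range_self)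
  · intro h
    refine ⟨P.markovSemigroup.comap hemb h, fun t f w => ?_⟩
    change _ = ∫ v, f (e v) ∂((P.transitionKernel t (e w)).comap e)
    rw [← hemb.integral_map, map_comap_eq_self_of_ae_mem_range hemb (h t w),
      integral_transitionKernel]

end Transition

section Power

variable {M : Type*} [TopologicalSpace M] [CompactSpace M]
  {P : ∀ n : ℕ, FellerSemigroup (Fin n → M)}

/-- Compatibility of a family of Feller semigroups on the spaces `C(M^n)`: the semigroup on
`C(M^n)` acts as the one on `C(M^k)` on functions of `k` of the `n` coordinates. This is the
condition `IsCDP.compatible`, and as there the index `0` is not used. -/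
def IsCompatible (P : ∀ n : ℕ, FellerSemigroup (Fin n → M)) : Prop :=
  ∀ k n : ℕ, 1 ≤ k → k < n → ∀ i : Fin k → Fin n, Function.Injective i →
    ∀ (t : ℝ≥0) (f : C(Fin n → M, ℝ)) (g : C(Fin k → M, ℝ)),
      (∀ x : Fin n → M, f x = g (fun j => x (i j))) →
      ∀ x : Fin n → M, (P n).op t f x = (P k).op t g (fun j => x (i j))

theorem IsCompatible.op_comp_eval (hP : IsCompatible P) {n : ℕ} (j : Fin n) (t : ℝ≥0)
    (f : C(M, ℝ)) (x : Fin n → M) :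
    (P n).op t (f.comp (.eval j)) x = (P 1).op t (f.comp (.eval 0)) fun _ => x j := by
  obtain rfl | hn : n = 1 ∨ 1 < n := by have := j.pos; omega
  · have hx : (fun _ => x j) = x := funext fun i => by rw [Subsingleton.elim i j]
    rw [hx, Subsingleton.elim j 0]
  · exact hP 1 n le_rfl hn (fun _ => j) (Function.injective_of_subsingleton _) t _ _
      (fun _ => rfl) x

variable [T2Space M] [SecondCountableTopology M]

theorem IsCompatible.map_eval_transitionKernel [MeasurableSpace M] [BorelSpace M]
    (hP : IsCompatible P) {n k : ℕ} {j : Fin n} {i : Fin k} {x : Fin n → M}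
    {y : Fin k → M} (hxy : x j = y i) (t : ℝ≥0) :
    ((P n).transitionKernel t x).map (· j) = ((P k).transitionKernel t y).map (· i) := by
  have integral_eval {l : ℕ} (r : Fin l) (z : Fin l → M) (f : C(M, ℝ)) :
      ∫ a, f a ∂(((P l).transitionKernel t z).map (· r)) =
        (P 1).op t (f.comp (.eval 0)) fun _ => z r := by
    rw [integral_map (measurable_pi_apply r).aemeasurable f.continuous.aestronglyMeasurable,
      ← hP.op_comp_eval, ← integral_transitionKernel]
    rfl
  exact measure_ext_of_forall_integral_continuousMap fun f => by
    rw [integral_eval, integral_eval, hxy]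

theorem IsCompatible.ae_eval_mem_iff [MeasurableSpace M] [BorelSpace M]
    (hP : IsCompatible P) {n k : ℕ} {j : Fin n} {i : Fin k} {x : Fin n → M}
    {y : Fin k → M} (hxy : x j = y i) (t : ℝ≥0) {s : Set M} (hs : MeasurableSet s) :
    (∀ᵐ z ∂((P n).transitionKernel t x), z j ∈ s) ↔
      ∀ᵐ z ∂((P k).transitionKernel t y), z i ∈ s := by
  have ae_eval_mem {l : ℕ} (r : Fin l) (μ : Measure (Fin l → M)) :
      (∀ᵐ a ∂(μ.map (· r)), a ∈ s) ↔ ∀ᵐ z ∂μ, z r ∈ s :=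
    ae_map_iff (measurable_pi_apply r).aemeasurable hs
  rw [← ae_eval_mem, ← ae_eval_mem, hP.map_eval_transitionKernel hxy]

theorem IsCompatible.isDegenerate_pi (hP : IsCompatible P) {n k : ℕ} (hk : 1 ≤ k)
    {W : Fin n → Type*} [∀ j, TopologicalSpace (W j)] [∀ j, SigmaCompactSpace (W j)]
    {e : ∀ j, W j → M} (he : ∀ j, Continuous (e j)) (hinj : ∀ j, Function.Injective (e j))
    (h : ∀ j, (P k).IsDegenerate fun (w : Fin k → W j) i => e j (w i)) :
    (P n).IsDegenerate fun (w : ∀ j, W j) j => e j (w j) := by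
  borelize M
  refine (isDegenerate_iff_forall_ae_mem_range _ (.piMap he) (.piMap hinj)).2 fun t w => ?_
  have coordinate_mem (j : Fin n) :
      ∀ᵐ z ∂((P n).transitionKernel t fun j => e j (w j)), z j ∈ range (e j) := by
    borelize (W j)
    have hrange := (measurableEmbedding_of_continuous_injective (he j) (hinj j)).measurableSet_range
    refine (hP.ae_eval_mem_iff (i := ⟨0, hk⟩) (y := fun _ => e j (w j)) rfl t hrange).2 ?_
    have hmem := (isDegenerate_iff_forall_ae_mem_range _ (.piMap fun _ => he j)
      (.piMap fun _ => hinj j)).1 (h j) t fun _ => w j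
    filter_upwards [hmem]
    rintro _ ⟨v, rfl⟩
    exact mem_range_self _
  filter_upwards [ae_all_iff.2 coordinate_mem] with z hz
  choose v hv using hz
  exact ⟨v, funext hv⟩

end Power

end FellerSemigroup

namespace Foliation

variable {m d q : ℕ} {M : Type*} [TopologicalSpace M] [ChartedSpace (EuclideanSpace ℝ (Fin m)) M]
  (F : Foliation m d q M)
  {ψ φ : OpenPartialHomeomorph M (EuclideanSpace ℝ (Fin d) × EuclideanSpace ℝ (Fin q))}
  {c c' : EuclideanSpace ℝ (Fin q)}

theorem mem_plaque_of_mem_source (hψ : ψ ∈ F.charts) (hφ : φ ∈ F.charts) {y z : M}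
    (hy : y ∈ plaque ψ c) (hyφ : y ∈ plaque φ c') (hz : z ∈ plaque ψ c) (hzφ : z ∈ φ.source) :
    z ∈ plaque φ c' := by
  obtain ⟨h, hh⟩ := F.transition ψ hψ φ hφ
  refine ⟨hzφ, ?_⟩
  rw [hh z ⟨hz.1, hzφ⟩, hz.2, ← hy.2, ← hh y ⟨hy.1, hyφ.1⟩, hyφ.2]

theorem exists_plaque_eq_image (hψ : ψ ∈ F.charts) (c : EuclideanSpace ℝ (Fin q)) :
    ∃ (V : Set (EuclideanSpace ℝ (Fin d))) (γ : EuclideanSpace ℝ (Fin d) → M),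
      IsOpen V ∧ IsPreconnected V ∧ ContinuousOn γ V ∧ plaque ψ c = γ '' V := by
  obtain ⟨U₁, U₂, hU₁, hU₁c, -, htarget⟩ := F.target_eq_prod ψ hψ
  have hmem {z : M} (hz : z ∈ plaque ψ c) : (ψ z).1 ∈ U₁ ∧ c ∈ U₂ := by
    have := htarget ▸ ψ.map_source hz.1
    exact ⟨this.1, hz.2 ▸ this.2⟩
  by_cases hc : c ∈ U₂
  · have hmaps : MapsTo (·, c) U₁ ψ.target := fun u hu => htarget ▸ ⟨hu, hc⟩
    refine ⟨U₁, fun u => ψ.symm (u, c), hU₁, hU₁c,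
      ψ.continuousOn_symm.comp (by fun_prop) hmaps, Subset.antisymm (fun z hz => ?_) ?_⟩
    · exact ⟨(ψ z).1, (hmem hz).1, by rw [← hz.2]; exact ψ.left_inv hz.1⟩
    · rintro _ ⟨u, hu, rfl⟩
      exact ⟨ψ.map_target (hmaps hu), by rw [ψ.right_inv (hmaps hu)]⟩
  · refine ⟨∅, ψ.symm ∘ (·, c), isOpen_empty, isPreconnected_empty, continuousOn_empty _, ?_⟩
    rw [image_empty]
    exact eq_empty_of_forall_notMem fun z hz => hc (hmem hz).2

theorem isPreconnected_plaque (hψ : ψ ∈ F.charts) (c : EuclideanSpace ℝ (Fin q)) :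
    IsPreconnected (plaque ψ c) := by
  obtain ⟨V, γ, -, hV, hγ, heq⟩ := F.exists_plaque_eq_image hψ c
  exact heq ▸ hV.image γ hγ

theorem isSigmaCompact_plaque (hψ : ψ ∈ F.charts) (c : EuclideanSpace ℝ (Fin q)) :
    IsSigmaCompact (plaque ψ c) := by
  obtain ⟨V, γ, hV, -, hγ, heq⟩ := F.exists_plaque_eq_image hψ c
  have := hV.locallyCompactSpace
  have hVσ : IsSigmaCompact V := isSigmaCompact_iff_sigmaCompactSpace.2 inferInstance
  exact heq ▸ hVσ.image_of_continuousOn hγ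

section CountablePlaques

variable {C : Set (OpenPartialHomeomorph M (EuclideanSpace ℝ (Fin d) × EuclideanSpace ℝ (Fin q)))}

/-- Two points lie in a common plaque of a chart of `C`. For `C` the whole atlas, leaves are the
classes of the equivalence relation which this generates; smaller `C` keep chains countable. -/
def PlaqueRel
    (C : Set (OpenPartialHomeomorph M (EuclideanSpace ℝ (Fin d) × EuclideanSpace ℝ (Fin q))))
    (y z : M) : Prop :=
  ∃ ψ ∈ C, ∃ c, y ∈ plaque ψ c ∧ z ∈ plaque ψ c

instance : Std.Symm (PlaqueRel C) where
  symm := fun _ _ ⟨ψ, hψ, c, hy, hz⟩ => ⟨ψ, hψ, c, hz, hy⟩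

variable {F}

-- A plaque is connected, and near each of its points it stays in one plaque of a chart of `C`.
theorem reflTransGen_plaqueRel_of_mem_plaque (hC : C ⊆ F.charts)
    (hcover : ∀ y, ∃ ψ ∈ C, y ∈ ψ.source) (hφ : φ ∈ F.charts) {y z : M} (hy : y ∈ plaque φ c)
    (hz : z ∈ plaque φ c) : Relation.ReflTransGen (PlaqueRel C) y z := by
  refine (F.isPreconnected_plaque hφ c).induction₂
    (Relation.ReflTransGen (PlaqueRel C)) (fun y hy => ?_)
    (fun _ _ _ _ _ _ => .trans) (fun _ _ _ _ => symm) hy hz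
  obtain ⟨ψ, hψ, hyψ⟩ := hcover y
  filter_upwards [self_mem_nhdsWithin, mem_nhdsWithin_of_mem_nhds (ψ.open_source.mem_nhds hyψ)]
    with z hz hzψ
  exact .single ⟨ψ, hψ, _, ⟨hyψ, rfl⟩,
    F.mem_plaque_of_mem_source hφ (hC hψ) hy ⟨hyψ, rfl⟩ hz hzψ⟩

theorem SameLeaf.reflTransGen_plaqueRel (hC : C ⊆ F.charts)
    (hcover : ∀ y, ∃ ψ ∈ C, y ∈ ψ.source) {x y : M} (h : F.SameLeaf x y) :
    Relation.ReflTransGen (PlaqueRel C) x y := by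
  induction h with
  | rel y z hyz =>
    obtain ⟨φ, hφ, c, hy, hz⟩ := hyz
    exact reflTransGen_plaqueRel_of_mem_plaque hC hcover hφ hy hz
  | refl => exact .refl
  | symm _ _ _ ih => exact symm ih
  | trans _ _ _ _ _ ih ih' => exact ih.trans ih'

/-- The label of the plaque reached from the plaque `p` by entering the charts listed in `l`, last
entry first, where `h ψ φ` is the transverse part of the change of charts from `ψ` to `φ`. -/
def chainPlaque {E : Type*} (h : C → C → E → E) (p : C × E) (l : List C) : C × E :=
  l.foldr (fun φ r => (φ, h r.1 φ r.2)) p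

theorem exists_mem_plaque_chainPlaque
    {h : C → C → EuclideanSpace ℝ (Fin q) → EuclideanSpace ℝ (Fin q)}
    (hh : ∀ ψ φ : C, ∀ z ∈ ψ.1.source ∩ φ.1.source, (φ.1 z).2 = h ψ φ (ψ.1 z).2)
    {p : C × EuclideanSpace ℝ (Fin q)} {x y : M} (hx : x ∈ plaque p.1.1 p.2)
    (hxy : Relation.ReflTransGen (PlaqueRel C) x y) :
    ∃ l, y ∈ plaque (chainPlaque h p l).1.1 (chainPlaque h p l).2 := by
  induction hxy with
  | refl => exact ⟨[], hx⟩
  | @tail y z _ hyz ih =>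
    obtain ⟨l, hl⟩ := ih
    obtain ⟨φ, hφ, c, hy, hz⟩ := hyz
    refine ⟨⟨φ, hφ⟩ :: l, hz.1, ?_⟩
    change (φ z).2 = h (chainPlaque h p l).1 ⟨φ, hφ⟩ (chainPlaque h p l).2
    rw [hz.2, ← hy.2, hh _ ⟨φ, hφ⟩ y ⟨hl.1, hy.1⟩, hl.2]

variable (F)

theorem exists_countable_subset_charts [LindelofSpace M] :
    ∃ C ⊆ F.charts, C.Countable ∧ ∀ y, ∃ ψ ∈ C, y ∈ ψ.source := by
  choose ψ hψ hmem using F.exists_mem_source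
  obtain ⟨t, ht, hcover⟩ :=
    countable_cover_nhds fun y => (ψ y).open_source.mem_nhds (hmem y)
  refine ⟨ψ '' t, image_subset_iff.2 fun y _ => hψ y, ht.image ψ, fun y => ?_⟩
  obtain ⟨z, hz, hyz⟩ := mem_iUnion₂.1 (hcover ▸ mem_univ y)
  exact ⟨ψ z, mem_image_of_mem ψ hz, hyz⟩

theorem exists_countable_plaques [LindelofSpace M] (x : M) :
    ∃ S : Set (OpenPartialHomeomorph M (EuclideanSpace ℝ (Fin d) × EuclideanSpace ℝ (Fin q)) ×
      EuclideanSpace ℝ (Fin q)), S.Countable ∧ (∀ p ∈ S, p.1 ∈ F.charts) ∧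
      ∀ y, F.SameLeaf x y → ∃ p ∈ S, y ∈ plaque p.1 p.2 := by
  obtain ⟨C, hC, hCcount, hcover⟩ := F.exists_countable_subset_charts
  have := hCcount.to_subtype
  choose h hh using fun ψ φ : C => F.transition ψ (hC ψ.2) φ (hC φ.2)
  obtain ⟨ψ, hψ, hx⟩ := hcover x
  let p : List C → C × EuclideanSpace ℝ (Fin q) := chainPlaque h (⟨ψ, hψ⟩, (ψ x).2)
  refine ⟨range fun l => ((p l).1.1, (p l).2), countable_range _, ?_, fun y hxy => ?_⟩
  · rintro _ ⟨l, rfl⟩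
    exact hC (p l).1.2
  · obtain ⟨l, hl⟩ := exists_mem_plaque_chainPlaque hh (p := (⟨ψ, hψ⟩, (ψ x).2)) ⟨hx, rfl⟩
      (hxy.reflTransGen_plaqueRel hC hcover)
    exact ⟨_, mem_range_self l, hl⟩

end CountablePlaques

theorem leafTopology_le : F.leafTopology ≤ ‹TopologicalSpace M› := fun O hO => by
  choose ψ hψ hx using F.exists_mem_source
  have heq : O = ⋃ x, O ∩ plaque (ψ x) (ψ x x).2 :=
    Subset.antisymm (fun x hxO => mem_iUnion.2 ⟨x, hxO, hx x, rfl⟩)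
      (iUnion_subset fun x => inter_subset_left)
  rw [heq]
  exact @isOpen_iUnion _ _ F.leafTopology _ fun x =>
    TopologicalSpace.isOpen_generateFrom_of_mem ⟨ψ x, hψ x, _, O, hO, rfl⟩

theorem continuous_leafTopology_of_forall_mem_plaque (hψ : ψ ∈ F.charts) {Y : Type*}
    [TopologicalSpace Y] {g : Y → M} (hg : Continuous g) (hmem : ∀ y, g y ∈ plaque ψ c) :
    Continuous[_, F.leafTopology] g := by
  refine continuous_generateFrom_iff.2 ?_
  rintro _ ⟨φ, hφ, c', O, hO, rfl⟩
  rcases (g ⁻¹' plaque φ c').eq_empty_or_nonempty with hempty | ⟨y, hy⟩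
  · rw [preimage_inter, hempty, inter_empty]
    exact isOpen_empty
  · have heq : g ⁻¹' (O ∩ plaque φ c') = g ⁻¹' (O ∩ φ.source) :=
      Subset.antisymm (fun z hz => ⟨hz.1, hz.2.1⟩) fun z hz =>
        ⟨hz.1, F.mem_plaque_of_mem_source hψ hφ (hmem y) hy (hmem z) hz.2⟩
    rw [heq]
    exact (hO.inter φ.open_source).preimage hg

namespace Leaf

theorem continuous_incl (x : M) : Continuous (incl F x) :=
  continuous_le_rng F.leafTopology_le continuous_induced_dom

theorem incl_injective (x : M) : Function.Injective (incl F x) :=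
  Subtype.val_injective

theorem isSigmaCompact_preimage_plaque (x : M) (hψ : ψ ∈ F.charts)
    (c : EuclideanSpace ℝ (Fin q)) : IsSigmaCompact (incl F x ⁻¹' plaque ψ c) := by
  rcases (incl F x ⁻¹' plaque ψ c).eq_empty_or_nonempty with hempty | ⟨y, hy⟩
  · exact hempty ▸ isSigmaCompact_empty
  · let g (z : plaque ψ c) : F.Leaf x := ⟨z, y.2.trans _ _ _ (.rel _ _ ⟨ψ, hψ, c, hy, z.2⟩)⟩
    have hg : Continuous g := continuous_induced_rng.2 <|
      F.continuous_leafTopology_of_forall_mem_plaque hψ continuous_subtype_val Subtype.property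
    have hrange : range g = incl F x ⁻¹' plaque ψ c :=
      Subset.antisymm (range_subset_iff.2 Subtype.property) fun z hz => ⟨⟨z.1, hz⟩, rfl⟩
    have := isSigmaCompact_iff_sigmaCompactSpace.1 (F.isSigmaCompact_plaque hψ c)
    exact hrange ▸ isSigmaCompact_range hg

instance [LindelofSpace M] (x : M) : SigmaCompactSpace (F.Leaf x) := by
  obtain ⟨S, hS, hcharts, hcover⟩ := F.exists_countable_plaques x
  have hunion : ⋃ p ∈ S, incl F x ⁻¹' plaque p.1 p.2 = univ :=
    eq_univ_of_forall fun y =>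
      let ⟨p, hp, hy⟩ := hcover y.1 y.2
      mem_iUnion₂.2 ⟨p, hp, hy⟩
  exact isSigmaCompact_univ_iff.1 <| hunion ▸ isSigmaCompact_biUnion hS fun p hp =>
    isSigmaCompact_preimage_plaque F x (hcharts p hp) p.2

end Leaf

end Foliation

theorem corollary3_general {M : Type*} [TopologicalSpace M] [T2Space M] [CompactSpace M]
    [SecondCountableTopology M] {P : ∀ n : ℕ, FellerSemigroup (Fin n → M)}
    (hP : FellerSemigroup.IsCompatible P) {k : ℕ} (hk : 1 ≤ k) (n : ℕ) :
    (∀ (W : Type*) [TopologicalSpace W] [SigmaCompactSpace W] (ι : W → M), Continuous ι →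
      Function.Injective ι →
        (P k).IsDegenerate (fun (w : Fin k → W) (j : Fin k) => ι (w j)) →
          (P n).IsDegenerate (fun (w : Fin n → W) (j : Fin n) => ι (w j))) ∧
    (∀ (m d q : ℕ) [ChartedSpace (EuclideanSpace ℝ (Fin m)) M] (F : Foliation m d q M),
      F.IsFoliatedPow k (P k) → F.IsFoliatedPow n (P n)) :=
  ⟨fun _ _ _ _ hι hinj h => hP.isDegenerate_pi hk (fun _ => hι) (fun _ => hinj) fun _ => h,
    fun _ _ _ _ F h x => hP.isDegenerate_pi hk (fun j => Foliation.Leaf.continuous_incl F (x j))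
      (fun j => Foliation.Leaf.incl_injective F (x j)) fun j => h fun _ => x j⟩

theorem corollary3 {m : ℕ} {M : Type*} [TopologicalSpace M] [T2Space M] [CompactSpace M]
    [ChartedSpace (EuclideanSpace ℝ (Fin m)) M] [IsManifold (𝓡 m) ∞ M]
    (P : ∀ n : ℕ, FellerSemigroup (Fin n → M)) (hP : IsCDP P) :
    (∀ (d : ℕ) (W : Type*) [TopologicalSpace W] [T2Space W] [SecondCountableTopology W]
      [ConnectedSpace W] [ChartedSpace (EuclideanSpace ℝ (Fin d)) W] [IsManifold (𝓡 d) ∞ W]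
      (ι : W → M), Manifold.IsImmersion (𝓡 d) (𝓡 m) ∞ ι → Function.Injective ι →
      ∀ k : ℕ, 1 ≤ k →
        (P k).IsDegenerate (fun (w : Fin k → W) (j : Fin k) => ι (w j)) →
        ∀ n : ℕ, 1 ≤ n →
          (P n).IsDegenerate (fun (w : Fin n → W) (j : Fin n) => ι (w j))) ∧
    (∀ (d q : ℕ) (F : Foliation m d q M),
      ∀ k : ℕ, 1 ≤ k → F.IsFoliatedPow k (P k) →
        ∀ n : ℕ, 1 ≤ n → F.IsFoliatedPow n (P n)) := by
  have := ChartedSpace.secondCountable_of_sigmaCompact (EuclideanSpace ℝ (Fin m)) M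
  refine ⟨fun d W _ _ _ _ _ _ ι hι hinj k hk h n _ => ?_, fun d q F k hk h n _ =>
    (corollary3_general.{_, 0} hP.compatible hk n).2 m d q F h⟩
  have := ChartedSpace.locallyCompactSpace (EuclideanSpace ℝ (Fin d)) W
  exact (corollary3_general hP.compatible hk n).1 W ι hι.contMDiff.continuous hinj h
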